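/- Let $p$ be a prime, $n$ an even positive integer, $V$ an $n$-dimensional vector space over $\mathbb{F}_p$ with a non-degenerate bilinear form $\langle\cdot,\cdot\rangle$, and $\zeta_p$ a complex primitive $p$-th root of unity. For $f:V\to\mathbb{F}_p$ and $a\in V$ put $W_f(a)=\sum_{x\in V}\zeta_p^{f(x)-\langle a,x\rangle}$. The function $f$ is called bent if $|W_f(a)|=p^{n/2}$ for all $a\in V$. A bent function $f$ is called weakly regular if there are a constant $\varepsilon\in\mathbb{C}$ and a function $f^*:V\to\mathbb{F}_p$ with $W_f(a)=\varepsilon p^{n/2}\zeta_p^{f^*(a)}$ for all $a\in V$, and regular if this holds with $\varepsilon=1$. Let $\Gamma=\{A_1,\dots,A_K\}$ be a partition of $V$ into $K$ nonempty sets, where $p\mid K$. A function $f:V\to\mathbb{F}_p$ is said to be generated by $\Gamma$ if for every $i\in\mathbb{F}_p$ exactly $K/p$ of the sets $A_j$ are contained in $f^{-1}(i)$. The partition $\Gamma$ is called a bent partition of depth $K$ if every function generated by $\Gamma$ is bent. (1) If $\Gamma$ is a bent partition of depth $K$ such that all the bent functions generated by $\Gamma$ are regular, or all of them are weakly regular but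 not regular, then $K$ is a power of $p$. (2) In particular, if $p=2$, then the depth $K$ of every bent partition $\Gamma$ of $V$ is a power of $2$. -/

import Mathlib

noncomputable section

namespace BentPartition

variable {p : ℕ} {V : Type*} [AddCommGroup V] [Module (ZMod p) V] [Fintype V]

/-- The Walsh transform `W_f(a) = ∑ x, ζ ^ (f x - ⟨a, x⟩)` of a `p`-ary function `f`, for a complex
`p`-th root of unity `ζ` and a bilinear form `B = ⟨·, ·⟩`. The exponent, an element of `ZMod p`,
is represented by its residue in `{0, …, p - 1}`. -/
def walsh (ζ : ℂ) (B : LinearMap.BilinForm (ZMod p) V) (f : V → ZMod p) (a : V) : ℂ :=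
  ∑ x : V, ζ ^ (f x - B a x).val

/-- `f` is bent: `|W_f(a)| = p ^ (n / 2)` for all `a`, where `n = dim V`. -/
def IsBent (ζ : ℂ) (B : LinearMap.BilinForm (ZMod p) V) (f : V → ZMod p) : Prop :=
  ∀ a : V, ‖walsh ζ B f a‖ = (p : ℝ) ^ ((Module.finrank (ZMod p) V : ℝ) / 2)

/-- There is a function `f' : V → ZMod p` with `W_f(a) = ε p ^ (n / 2) ζ ^ (f' a)` for all `a`,
where `n = dim V`. -/
def HasConstantUnit (ζ : ℂ) (B : LinearMap.BilinForm (ZMod p) V) (f : V → ZMod p) (ε : ℂ) : Prop :=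
  ∃ f' : V → ZMod p, ∀ a : V,
    walsh ζ B f a =
      ε * (((p : ℝ) ^ ((Module.finrank (ZMod p) V : ℝ) / 2) : ℝ) : ℂ) * ζ ^ (f' a).val

/-- `f` is a weakly regular bent function. -/
def IsWeaklyRegular (ζ : ℂ) (B : LinearMap.BilinForm (ZMod p) V) (f : V → ZMod p) : Prop :=
  IsBent ζ B f ∧ ∃ ε : ℂ, HasConstantUnit ζ B f ε

/-- `f` is a regular bent function. -/
def IsRegular (ζ : ℂ) (B : LinearMap.BilinForm (ZMod p) V) (f : V → ZMod p) : Prop :=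
  IsBent ζ B f ∧ HasConstantUnit ζ B f 1

variable [DecidableEq V]

/-- The depth of a partition of `V`: its number of (nonempty) blocks. -/
def depth (Γ : Finpartition (Finset.univ : Finset V)) : ℕ := Γ.parts.card

/-- For every `i`, the preimage of `i` under `f` contains exactly `K / p` blocks of `Γ`, where `K`
is the depth of `Γ`. -/
def GeneratedBy (Γ : Finpartition (Finset.univ : Finset V)) (f : V → ZMod p) : Prop :=
  ∀ i : ZMod p, (Γ.parts.filter (fun A => ∀ x ∈ A, f x = i)).card = depth Γ / p

/-- `Γ` is a bent partition: `p` divides its depth, and all functions generated by it are bent. -/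
def IsBentPartition (ζ : ℂ) (B : LinearMap.BilinForm (ZMod p) V)
    (Γ : Finpartition (Finset.univ : Finset V)) : Prop :=
  p ∣ depth Γ ∧ ∀ f : V → ZMod p, GeneratedBy Γ f → IsBent ζ B f

/-- `Γ` is a bent partition such that the bent functions generated by it are all regular, or are
all weakly regular but not regular. -/
def InClassWBP (ζ : ℂ) (B : LinearMap.BilinForm (ZMod p) V)
    (Γ : Finpartition (Finset.univ : Finset V)) : Prop :=
  IsBentPartition ζ B Γ ∧
    ((∀ f : V → ZMod p, GeneratedBy Γ f → IsRegular ζ B f) ∨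
      (∀ f : V → ZMod p, GeneratedBy Γ f → IsWeaklyRegular ζ B f ∧ ¬ IsRegular ζ B f))

end BentPartition

end

/-! Fix `a ≠ 0` and give each block `A` the character sum `χ A` of `x ↦ ψ (-B a x)`. A generated
function is a colouring of the blocks using each colour equally often, and its Walsh value at `a` is
`∑ ψ (c A) * χ A`. The hypotheses put all these values in `δ p ^ m ψ (ZMod p)` for one common `δ` of
modulus 1; a single `δ` is what makes different functions comparable. Exchanging the colours of two
blocks changes the normalised sum by the difference of their weights times `ψ s - ψ t`, and this
must again be a difference of values of `ψ`. That rigidity forces distinct weights to differ by a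
number of modulus 1, and then all weights but one to be equal (`exists_forall_ne_eq_of_odd`,
`exists_forall_ne_eq_of_two`). The weights sum to 0 by nondegeneracy, so some block has `K * ‖χ A‖ =
p ^ m`. As `χ A` is an algebraic integer, `K` divides a power of `p`. In the non-regular case `δ =
-1` works, because a sum of `p`-th roots of unity of modulus `p ^ m` is `± p ^ m ζ ^ r` for odd `p`.
-/

/-! ### Arithmetic of cyclotomic integers. -/

open NumberField NumberField.IsCMField in
-- `p` is totally ramified, and its only prime `π = ζ - 1` is associated to its conjugate. So `w`
-- and its conjugate contain `π` equally often, each taking half of the exponent.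
theorem natCast_pow_dvd_of_mul_complexConj {K : Type*} [Field K] [NumberField K] {p : ℕ}
    [hp : Fact p.Prime] [IsCyclotomicExtension {p} ℚ K] [IsCMField K] {ζ : K}
    (hζ : IsPrimitiveRoot ζ p) {w : 𝓞 K} {m : ℕ}
    (hw : w * ringOfIntegersComplexConj K w = (p : 𝓞 K) ^ (2 * m)) : (p : 𝓞 K) ^ m ∣ w := by
  set σ := ringOfIntegersComplexConj K
  have hprime : Prime (hζ.toInteger - 1) := hζ.zeta_sub_one_prime'
  have hassoc : Associated ((hζ.toInteger - 1) ^ (p - 1)) (p : 𝓞 K) :=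
    IsCyclotomicExtension.Rat.associated_zeta_sub_one_pow_prime p hζ
  set π := hζ.toInteger - 1 with hπ
  have hσπ : Associated π (σ π) := by
    have h : IsPrimitiveRoot (complexConj K ζ) p := hζ.map_of_injective (complexConj K).injective
    have := IsCyclotomicExtension.Rat.associated_sub_one_of_isPrimitiveRoot p hζ h
    convert! this using 1
    rw [hπ, map_sub, map_one]
    rfl
  have hp0 : (p : 𝓞 K) ≠ 0 := Nat.cast_ne_zero.mpr hp.out.ne_zero
  have hw0 : w ≠ 0 := by
    rintro rfl
    rw [zero_mul] at hw
    exact pow_ne_zero _ hp0 hw.symm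
  have hfin : FiniteMultiplicity π w := FiniteMultiplicity.of_prime_left hprime hw0
  obtain ⟨u, hu, hndvd⟩ := hfin.exists_eq_pow_mul_and_not_dvd
  set a := multiplicity π w
  have hndvd' : ¬ π ∣ σ u := fun h ↦ hndvd ((map_dvd_iff σ).mp (hσπ.symm.dvd.trans h))
  have h1 : Associated (π ^ (2 * a) * (u * σ u)) (π ^ ((p - 1) * (2 * m))) := by
    have h2 : Associated (w * σ w) (π ^ (2 * a) * (u * σ u)) := by
      rw [hu, map_mul, map_pow,
        show π ^ a * u * (σ π ^ a * σ u) = π ^ a * (σ π ^ a) * (u * σ u) by ring,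
        two_mul, pow_add]
      exact ((Associated.refl _).mul_mul (hσπ.symm.pow_pow)).mul_mul (Associated.refl _)
    rw [pow_mul π (p - 1)]
    exact h2.symm.trans (hw ▸ (hassoc.pow_pow).symm)
  have hndvd2 : ¬ π ∣ u * σ u := fun h ↦ (hprime.dvd_or_dvd h).elim hndvd hndvd'
  have ha : (p - 1) * (2 * m) ≤ 2 * a := by
    have h := hprime.pow_dvd_of_dvd_mul_right _ hndvd2 h1.symm.dvd
    exact (pow_dvd_pow_iff hprime.ne_zero hprime.not_isUnit).mp h
  have ha' : (p - 1) * m ≤ a := by nlinarith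
  rw [hu]
  refine Dvd.dvd.mul_right ?_ _
  refine (hassoc.pow_pow (n := m)).symm.dvd.trans ?_
  rw [← pow_mul]
  exact pow_dvd_pow _ ha'

open NumberField NumberField.IsCMField in
theorem eq_pow_or_eq_neg_pow_of_norm_eq {p : ℕ} [hp : Fact p.Prime] (hp2 : p ≠ 2) {ζ : ℂ}
    (hζ : IsPrimitiveRoot ζ p) {ι : Type*} (s : Finset ι) (e : ι → ℕ) {m : ℕ}
    (h : ‖∑ i ∈ s, ζ ^ e i‖ = (p : ℝ) ^ m) :
    ∃ r : ℕ, ∑ i ∈ s, ζ ^ e i = (p : ℂ) ^ m * ζ ^ r ∨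
      ∑ i ∈ s, ζ ^ e i = -((p : ℂ) ^ m * ζ ^ r) := by
  have : NeZero ((p : ℕ) : ℚ) := ⟨Nat.cast_ne_zero.mpr hp.out.ne_zero⟩
  obtain ⟨K, _, _, _⟩ : ∃ (K : Type) (_ : Field K) (_ : NumberField K),
      IsCyclotomicExtension {p} ℚ K :=
    ⟨CyclotomicField p ℚ, CyclotomicField.instField p ℚ, inferInstance, by
      convert! CyclotomicField.isCyclotomicExtension p ℚ⟩
  have hp3 : 2 < p := lt_of_le_of_ne hp.out.two_le (Ne.symm hp2)
  have : IsCMField K := IsCyclotomicExtension.Rat.isCMField K (S := {p}) ⟨p, rfl, hp3⟩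
  let φ : K →+* ℂ := (IsAlgClosed.lift (R := ℚ) : K →ₐ[ℚ] ℂ).toRingHom
  obtain ⟨z, hz, hφz⟩ : ∃ z : K, IsPrimitiveRoot z p ∧ φ z = ζ := by
    have h0 := IsCyclotomicExtension.zeta_spec p ℚ K
    obtain ⟨i, -, hi, hi'⟩ := (h0.map_of_injective φ.injective).isPrimitiveRoot_iff.mp hζ
    exact ⟨_, h0.pow_of_coprime i hi, by rw [map_pow, hi']⟩
  let w : 𝓞 K := ∑ i ∈ s, hz.toInteger ^ e i
  have hφw : φ (algebraMap (𝓞 K) K w) = ∑ i ∈ s, ζ ^ e i := by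
    simp only [w, map_sum, map_pow, ← hφz]
    rfl
  have hw : w * ringOfIntegersComplexConj K w = (p : 𝓞 K) ^ (2 * m) := by
    apply RingOfIntegers.ext
    apply φ.injective
    change φ (algebraMap (𝓞 K) K _) = φ (algebraMap (𝓞 K) K _)
    have : algebraMap (𝓞 K) K (ringOfIntegersComplexConj K w) =
        complexConj K (algebraMap (𝓞 K) K w) := rfl
    rw [map_mul (algebraMap (𝓞 K) K), map_mul φ, this, complexEmbedding_complexConj, Complex.mul_conj,
      hφw, Complex.normSq_eq_norm_sq, h]
    simp
    ring
  obtain ⟨v, hv⟩ := natCast_pow_dvd_of_mul_complexConj hz hw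
  have hnorm : ∀ ψ : K →+* ℂ, ‖ψ (algebraMap (𝓞 K) K v)‖ = 1 := by
    intro ψ
    have h1 : ‖ψ (algebraMap (𝓞 K) K w)‖ ^ 2 = (p : ℝ) ^ (2 * m) := by
      have := congrArg (fun t : 𝓞 K ↦ ψ (algebraMap (𝓞 K) K t)) hw
      have h2 : algebraMap (𝓞 K) K (ringOfIntegersComplexConj K w) =
        complexConj K (algebraMap (𝓞 K) K w) := rfl
      simp only [map_mul, h2, complexEmbedding_complexConj, Complex.mul_conj,
        Complex.normSq_eq_norm_sq] at this
      simp only [map_pow, map_natCast] at this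
      exact_mod_cast this
    have h2 : ψ (algebraMap (𝓞 K) K w) = (p : ℂ) ^ m * ψ (algebraMap (𝓞 K) K v) := by rw [hv]; simp
    rw [h2, norm_mul, norm_pow, Complex.norm_natCast, mul_pow, ← pow_mul, mul_comm m 2] at h1
    have h3 : ‖ψ (algebraMap (𝓞 K) K v)‖ ^ 2 = 1 :=
      mul_left_cancel₀ (pow_ne_zero _ (Nat.cast_ne_zero.mpr hp.out.ne_zero))
        (h1.trans (mul_one _).symm)
    exact (pow_eq_one_iff_of_nonneg (norm_nonneg _) two_ne_zero).mp h3
  -- Kronecker: an algebraic integer with all conjugates on the unit circle is a root of unity.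
  obtain ⟨k, hk, hk'⟩ := Embeddings.pow_eq_one_of_norm_eq_one K ℂ v.isIntegral_coe hnorm
  obtain ⟨r, -, hr⟩ := hz.exists_pow_or_neg_mul_pow_of_isOfFinOrder
    (hp.out.odd_of_ne_two hp2) (isOfFinOrder_iff_pow_eq_one.mpr ⟨k, hk, hk'⟩)
  refine ⟨r, ?_⟩
  have h2 : φ (algebraMap (𝓞 K) K w) = (p : ℂ) ^ m * φ (algebraMap (𝓞 K) K v) := by rw [hv]; simp
  rw [← hφw, h2]
  rcases hr with hr | hr
  · left; rw [hr, map_pow, hφz]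
  · right; rw [hr, map_neg, map_pow, hφz, mul_neg]

/-- `z` times its conjugate is the rational `p ^ (2 * m) / k ^ 2`; being integral over `ℤ`, it is an
integer. -/
theorem exists_eq_pow_of_norm_eq_div {p : ℕ} [hp : Fact p.Prime] {z : ℂ} (hz : IsIntegral ℤ z)
    {k m : ℕ} (hk : k ≠ 0) (h : (k : ℝ) * ‖z‖ = (p : ℝ) ^ m) : ∃ r : ℕ, k = p ^ r := by
  have h1 : IsIntegral ℤ (z * (starRingEnd ℂ) z) :=
    hz.mul (hz.map ((starRingEnd ℂ).toIntAlgHom))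
  have hk0 : (k : ℝ) ≠ 0 := Nat.cast_ne_zero.mpr hk
  have h2 : z * (starRingEnd ℂ) z = algebraMap ℚ ℂ ((p : ℚ) ^ (2 * m) / (k : ℚ) ^ 2) := by
    rw [Complex.mul_conj, Complex.normSq_eq_norm_sq, (eq_div_iff hk0).mpr ((mul_comm _ _).trans h)]
    simp [div_pow, ← pow_mul, mul_comm m 2]
  rw [h2, isIntegral_algebraMap_iff (algebraMap ℚ ℂ).injective,
    IsIntegrallyClosed.isIntegral_iff] at h1
  obtain ⟨y, hy⟩ := h1
  have h3 : (p : ℤ) ^ (2 * m) = (k : ℤ) * (k * y) := by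
    have : (k : ℚ) ≠ 0 := Nat.cast_ne_zero.mpr hk
    field_simp at hy
    have hy' : (y : ℚ) * k ^ 2 = p ^ (2 * m) := by rw [← hy]; simp
    have h4 : y * (k : ℤ) ^ 2 = p ^ (2 * m) := by exact_mod_cast hy'
    rw [← h4]; ring
  have h4 : k ∣ p ^ (2 * m) := by
    have : (k : ℤ) ∣ ((p ^ (2 * m) : ℕ) : ℤ) := ⟨k * y, by push_cast; exact h3⟩
    exact_mod_cast this
  obtain ⟨r, -, hr⟩ := (Nat.dvd_prime_pow hp.out).mp h4
  exact ⟨r, hr⟩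

/-! ### Chords of the unit circle and colour exchanges. -/

/-- Conjugation inverts unit complex numbers, so conjugating `h` gives `u * v = a * b`. Hence `{u,
-v}` and `{a, -b}` have the same sum and product. -/
theorem eq_or_eq_neg_of_unit_chord {a b u v : ℂ} (ha : ‖a‖ = 1) (hb : ‖b‖ = 1) (hu : ‖u‖ = 1)
    (hv : ‖v‖ = 1) (hab : a ≠ b) (h : a - b = u - v) : (u = a ∧ v = b) ∨ (u = -b ∧ v = -a) := by
  have ha0 : a ≠ 0 := norm_ne_zero_iff.mp (by rw [ha]; exact one_ne_zero)
  have hb0 : b ≠ 0 := norm_ne_zero_iff.mp (by rw [hb]; exact one_ne_zero)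
  have hu0 : u ≠ 0 := norm_ne_zero_iff.mp (by rw [hu]; exact one_ne_zero)
  have hv0 : v ≠ 0 := norm_ne_zero_iff.mp (by rw [hv]; exact one_ne_zero)
  have hconj := congrArg (starRingEnd ℂ) h
  rw [map_sub, map_sub, ← Complex.inv_eq_conj ha, ← Complex.inv_eq_conj hb,
    ← Complex.inv_eq_conj hu, ← Complex.inv_eq_conj hv] at hconj
  field_simp at hconj
  have hprod : u * v = a * b := by
    apply mul_left_cancel₀ (sub_ne_zero.mpr hab)
    linear_combination -hconj - (a * b) * h
  have hzero : (u - a) * (u + b) = 0 := by linear_combination hprod - u * h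
  rcases mul_eq_zero.mp hzero with h1 | h1
  · left
    refine ⟨sub_eq_zero.mp h1, ?_⟩
    linear_combination h1 + h
  · right
    refine ⟨eq_neg_of_add_eq_zero_left h1, ?_⟩
    linear_combination h1 + h

namespace AddChar

variable {F : Type*} [AddCommGroup F] [Fintype F] (ψ : AddChar F ℂ)

theorem norm_apply_sub_apply (s t : F) : ‖ψ s - ψ t‖ = ‖ψ (s - t) - 1‖ := by
  have h : ψ s - ψ t = (ψ (s - t) - 1) * ψ t := by
    rw [sub_mul, ← AddChar.map_add_eq_mul, sub_add_cancel, one_mul]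
  rw [h, norm_mul, AddChar.norm_apply, mul_one]

/-- Scaling by `‖d‖` maps the finite set of nonzero chord lengths `‖ψ i - 1‖` into itself; compare
its maximum and minimum. -/
theorem norm_eq_one_of_mul_sub_eq [Nontrivial F] (hψ : Function.Injective ψ) {d : ℂ} (hd : d ≠ 0)
    (h : ∀ s t : F, s ≠ t → ∃ u v : F, d * (ψ s - ψ t) = ψ u - ψ v) : ‖d‖ = 1 := by
  classical
  let S : Finset F := Finset.univ.filter (· ≠ 0)
  have hS : S.Nonempty := by
    obtain ⟨i, hi⟩ := exists_ne (0 : F)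
    exact ⟨i, by simp [S, hi]⟩
  have hpos : ∀ i ∈ S, 0 < ‖ψ i - 1‖ := by
    intro i hi
    rw [norm_pos_iff, sub_ne_zero, ← AddChar.map_zero_eq_one ψ]
    exact hψ.ne (by simpa [S] using hi)
  have hstep : ∀ i ∈ S, ∃ l ∈ S, ‖d‖ * ‖ψ i - 1‖ = ‖ψ l - 1‖ := by
    intro i hi
    have hi0 : i ≠ 0 := by simpa [S] using hi
    obtain ⟨u, v, huv⟩ := h i 0 hi0
    have hnorm : ‖d‖ * ‖ψ i - 1‖ = ‖ψ (u - v) - 1‖ := by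
      rw [← norm_apply_sub_apply, ← huv, norm_mul, AddChar.map_zero_eq_one]
    refine ⟨u - v, ?_, hnorm⟩
    simp only [S, Finset.mem_filter, Finset.mem_univ, true_and]
    intro huv0
    rw [huv0, AddChar.map_zero_eq_one, sub_self, norm_zero] at hnorm
    exact (mul_pos (norm_pos_iff.mpr hd) (hpos i hi)).ne' hnorm
  apply le_antisymm
  · obtain ⟨i, hi, hmax⟩ := S.exists_max_image (fun i ↦ ‖ψ i - 1‖) hS
    obtain ⟨l, hl, hil⟩ := hstep i hi
    have := hmax l hl
    rw [← hil] at this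
    exact le_of_mul_le_mul_right (by simpa using this) (hpos i hi)
  · obtain ⟨i, hi, hmin⟩ := S.exists_min_image (fun i ↦ ‖ψ i - 1‖) hS
    obtain ⟨l, hl, hil⟩ := hstep i hi
    have := hmin l hl
    rw [← hil] at this
    exact le_of_mul_le_mul_right (by simpa using this) (hpos i hi)

variable {ι : Type*} [Fintype ι] [DecidableEq ι]

/-- The value `∑ j, ψ (c j) * x j` of a colouring `c` of `ι` at a family `x` of weights. -/
def coloringSum (x : ι → ℂ) (c : ι → F) : ℂ := ∑ j, ψ (c j) * x j

omit [Fintype F] in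
theorem coloringSum_swap (x : ι → ℂ) (c : ι → F) {j k : ι} (hjk : j ≠ k) :
    coloringSum ψ x (c ∘ Equiv.swap j k) =
      coloringSum ψ x c + (x k - x j) * (ψ (c j) - ψ (c k)) := by
  rw [← sub_eq_iff_eq_add', coloringSum, coloringSum, ← Finset.sum_sub_distrib,
    Fintype.sum_eq_add j k hjk]
  · simp only [Function.comp, Equiv.swap_apply_left, Equiv.swap_apply_right]
    ring
  · rintro i ⟨hij, hik⟩
    simp only [Function.comp, Equiv.swap_apply_of_ne_of_ne hij hik, sub_self]

omit [Fintype F] [AddCommGroup F] [Fintype ι] [DecidableEq ι] in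
theorem exists_coloring {C : Set (ι → F)} (hC : ∀ c ∈ C, ∀ σ : Equiv.Perm ι, c ∘ σ ∈ C)
    {c : ι → F} (hc : c ∈ C) {n : ℕ} {f g : Fin n → ι} (hf : Function.Injective f)
    (hg : Function.Injective g) : ∃ c' ∈ C, ∀ i, c' (f i) = c (g i) := by
  obtain ⟨σ, hσ⟩ := Equiv.Perm.exists_extending_pair f g hf hg
  exact ⟨c ∘ σ, hC c hc σ, fun i ↦ by simp [hσ i]⟩

omit [Fintype F] [AddCommGroup F] [Fintype ι] [DecidableEq ι] in
theorem exists_coloring_of_injective {C : Set (ι → F)}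
    (hC : ∀ c ∈ C, ∀ σ : Equiv.Perm ι, c ∘ σ ∈ C) {c : ι → F} (hc : c ∈ C)
    (hsurj : Function.Surjective c) {n : ℕ} {f : Fin n → ι} (hf : Function.Injective f)
    {t : Fin n → F} (ht : Function.Injective t) : ∃ c' ∈ C, ∀ i, c' (f i) = t i := by
  obtain ⟨c', hc', h⟩ := exists_coloring hC hc hf
    (g := Function.surjInv hsurj ∘ t) ((Function.injective_surjInv hsurj).comp ht)
  exact ⟨c', hc', fun i ↦ by rw [h i]; exact Function.surjInv_eq hsurj _⟩

variable {C : Set (ι → F)} (hC : ∀ c ∈ C, ∀ σ : Equiv.Perm ι, c ∘ σ ∈ C) {x : ι → ℂ}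
  (hx : ∀ c ∈ C, ∃ u, coloringSum ψ x c = ψ u)

include hC hx in
theorem coloringSum_eq_or [Nontrivial F] (hψ : Function.Injective ψ) {c₀ : ι → F} (hc₀ : c₀ ∈ C)
    (hsurj : Function.Surjective c₀) {j k : ι} (hjk : x j ≠ x k) :
    ‖x k - x j‖ = 1 ∧ ∀ c ∈ C, c j ≠ c k →
      coloringSum ψ x c = (x k - x j) * ψ (c k) ∨
      coloringSum ψ x c = -((x k - x j) * ψ (c j)) := by
  have hne : j ≠ k := fun h ↦ hjk (congrArg x h)
  have hd : ‖x k - x j‖ = 1 := by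
    refine norm_eq_one_of_mul_sub_eq ψ hψ (sub_ne_zero.mpr hjk.symm) fun s t hst ↦ ?_
    have hf : Function.Injective ![j, k] := by
      simp [Function.Injective, Fin.forall_fin_two, hne, hne.symm]
    have ht : Function.Injective ![s, t] := by
      simp [Function.Injective, Fin.forall_fin_two, hst, hst.symm]
    obtain ⟨c, hc, hct⟩ := exists_coloring_of_injective hC hc₀ hsurj hf ht
    obtain ⟨u, hu⟩ := hx _ (hC c hc (Equiv.swap j k))
    obtain ⟨v, hv⟩ := hx c hc
    have hj : c j = s := hct 0
    have hk : c k = t := hct 1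
    refine ⟨u, v, ?_⟩
    rw [← hu, ← hv, coloringSum_swap ψ x c hne, hj, hk, add_sub_cancel_left]
  refine ⟨hd, fun c hc hcjk ↦ ?_⟩
  obtain ⟨u, hu⟩ := hx _ (hC c hc (Equiv.swap j k))
  obtain ⟨v, hv⟩ := hx c hc
  have hchord := eq_or_eq_neg_of_unit_chord (a := (x k - x j) * ψ (c j))
    (b := (x k - x j) * ψ (c k)) (u := ψ u) (v := ψ v) (by simp [hd]) (by simp [hd]) (by simp)
    (by simp) (fun h ↦ hcjk (hψ (mul_left_cancel₀ (sub_ne_zero.mpr hjk.symm) h)))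
    (by rw [← hu, ← hv, coloringSum_swap ψ x c hne]; ring)
  rw [hv]
  exact hchord.imp And.right And.right

include hC hx in
-- Once the sum depends only on the colour of `k`, exchanging the colours of `j` and any third `l`
-- leaves it unchanged, so `x l = x j`. Three distinct colours are needed for this.
theorem exists_forall_ne_eq_of_odd [Nontrivial F] (hψ : Function.Injective ψ) {c₀ : ι → F}
    (hc₀ : c₀ ∈ C) (hsurj : Function.Surjective c₀) {p : ℕ} (hp : Odd p)
    (hF : ∀ s : F, p • s = 0) (h3 : 3 ≤ Fintype.card F) {j k : ι} (hjk : x j ≠ x k) :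
    ∃ j k, ‖x k - x j‖ = 1 ∧ ∀ l ≠ k, x l = x j := by
  have hpow : ∀ s, ψ s ^ p = 1 := fun s ↦ by
    rw [← AddChar.map_nsmul_eq_pow, hF, AddChar.map_zero_eq_one]
  obtain ⟨j, k, hjk, hW⟩ : ∃ j k, x j ≠ x k ∧
      ∀ c ∈ C, c j ≠ c k → coloringSum ψ x c = (x k - x j) * ψ (c k) := by
    have h := (coloringSum_eq_or ψ hC hx hψ hc₀ hsurj hjk).2
    -- For odd `p`, `-1` is not a `p`-th root of unity, so only one of the two alternatives can
    -- occur; which one depends on the pair alone, not on `c`.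
    by_cases hd : (x k - x j) ^ p = 1
    · refine ⟨j, k, hjk, fun c hc hcjk ↦ (h c hc hcjk).resolve_right fun h' ↦ ?_⟩
      obtain ⟨u, hu⟩ := hx c hc
      have h1 := congrArg (· ^ p) (hu.symm.trans h')
      simp only [hp.neg_pow, mul_pow, hpow, hd] at h1
      norm_num at h1
    · refine ⟨k, j, hjk.symm, fun c hc hcjk ↦ ?_⟩
      rw [(h c hc hcjk.symm).resolve_left fun h' ↦ hd ?_]
      · ring
      · obtain ⟨u, hu⟩ := hx c hc
        have h1 := congrArg (· ^ p) (hu.symm.trans h')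
        simpa only [mul_pow, hpow, mul_one, eq_comm] using h1
  refine ⟨j, k, (coloringSum_eq_or ψ hC hx hψ hc₀ hsurj hjk).1, fun l hlk ↦ ?_⟩
  by_cases hlj : l = j
  · rw [hlj]
  have hne : j ≠ k := fun h ↦ hjk (congrArg x h)
  obtain ⟨e⟩ : Nonempty (Fin 3 ↪ F) := Function.Embedding.nonempty_of_card_le (by simpa using h3)
  have hf : Function.Injective ![j, k, l] := by
    simp [Function.Injective, Fin.forall_fin_succ, hne, hne.symm, hlk, Ne.symm hlk, hlj,
      Ne.symm hlj]
  obtain ⟨c, hc, hct⟩ := exists_coloring_of_injective hC hc₀ hsurj hf e.injective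
  have hcj : c j = e 0 := hct 0
  have hck : c k = e 1 := hct 1
  have hcl : c l = e 2 := hct 2
  have h1 := hW c hc (by rw [hcj, hck]; exact e.injective.ne (by decide))
  have h2 := hW _ (hC c hc (Equiv.swap j l)) (by
    simp only [Function.comp, Equiv.swap_apply_left, Equiv.swap_apply_of_ne_of_ne hne.symm hlk.symm]
    rw [hcl, hck]; exact e.injective.ne (by decide))
  rw [coloringSum_swap ψ x c (Ne.symm hlj)] at h2
  simp only [Function.comp, Equiv.swap_apply_of_ne_of_ne hne.symm hlk.symm] at h2
  rw [h1, add_eq_left] at h2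
  refine sub_eq_zero.mp ((mul_eq_zero.mp h2).resolve_right (sub_ne_zero.mpr (hψ.ne ?_)))
  rw [hcj, hcl]; exact e.injective.ne (by decide)

include hC hx in
-- With exponent 2, distinct colours have opposite `ψ`, so the two alternatives of
-- `coloringSum_eq_or` coincide. Two disjoint unequal pairs are compared instead of three colours.
theorem exists_forall_ne_eq_of_two [Nontrivial F] (hψ : Function.Injective ψ) {c₀ : ι → F}
    (hc₀ : c₀ ∈ C) (hsurj : Function.Surjective c₀) (hF : ∀ s : F, 2 • s = 0)
    {s t : F} (hst : s ≠ t) {g : Fin 4 → ι} (hg : Function.Injective g)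
    (hc₀g : ∀ i, c₀ (g i) = ![s, t, s, t] i) {j k : ι} (hjk : x j ≠ x k) :
    ∃ j k, ‖x k - x j‖ = 1 ∧ ∀ l ≠ k, x l = x j := by
  have hpow : ∀ s, ψ s ^ 2 = 1 := fun s ↦ by
    rw [← AddChar.map_nsmul_eq_pow, hF, AddChar.map_zero_eq_one]
  have hneg : ∀ s t, s ≠ t → ψ s = -ψ t := fun s t hst ↦
    (sq_eq_sq_iff_eq_or_eq_neg.mp ((hpow s).trans (hpow t).symm)).resolve_left (hψ.ne hst)
  have hW : ∀ j k, x j ≠ x k → ∀ c ∈ C, c j ≠ c k →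
      coloringSum ψ x c = (x k - x j) * ψ (c k) := by
    intro j k hjk c hc hcjk
    rcases (coloringSum_eq_or ψ hC hx hψ hc₀ hsurj hjk).2 c hc hcjk with h | h
    · exact h
    · rw [h, hneg _ _ hcjk]; ring
  have hsq : ∀ j k, x j ≠ x k → (x k - x j) ^ 2 = 1 := by
    intro j k hjk
    have hne : j ≠ k := fun h ↦ hjk (congrArg x h)
    have hf : Function.Injective ![j, k] := by
      simp [Function.Injective, Fin.forall_fin_two, hne, hne.symm]
    have ht : Function.Injective ![s, t] := by
      simp [Function.Injective, Fin.forall_fin_two, hst, hst.symm]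
    obtain ⟨c, hc, hct⟩ := exists_coloring_of_injective hC hc₀ hsurj hf ht
    have hj : c j = s := hct 0
    have hk : c k = t := hct 1
    obtain ⟨u, hu⟩ := hx c hc
    have h1 := congrArg (· ^ 2) (hu.symm.trans (hW j k hjk c hc (by rwa [hj, hk])))
    simpa only [mul_pow, hpow, mul_one, eq_comm] using h1
  have hdisj : ∀ l m, l ≠ j → l ≠ k → m ≠ j → m ≠ k → x l = x m := by
    intro l m hlj hlk hmj hmk
    by_contra hlm
    have hne : j ≠ k := fun h ↦ hjk (congrArg x h)
    have hne' : l ≠ m := fun h ↦ hlm (congrArg x h)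
    have hf : Function.Injective ![j, k, l, m] := by
      simp [Function.Injective, Fin.forall_fin_succ, hne, hne.symm, hne', hne'.symm, hlj, hlk,
        hmj, hmk, hlj.symm, hlk.symm, hmj.symm, hmk.symm]
    have hf' : Function.Injective ![j, k, m, l] := by
      simp [Function.Injective, Fin.forall_fin_succ, hne, hne.symm, hne', hne'.symm, hlj, hlk,
        hmj, hmk, hlj.symm, hlk.symm, hmj.symm, hmk.symm]
    -- The two colourings give `j, k` the same colours but exchange those of `l, m`: one expression
    -- for the sum keeps its sign and the other changes it.
    obtain ⟨c, hc, hcf⟩ := exists_coloring hC hc₀ hf hg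
    obtain ⟨c', hc', hcf'⟩ := exists_coloring hC hc₀ hf' hg
    simp only [hc₀g] at hcf hcf'
    have cj : c j = s := hcf 0
    have ck : c k = t := hcf 1
    have cl : c l = s := hcf 2
    have cm : c m = t := hcf 3
    have cj' : c' j = s := hcf' 0
    have ck' : c' k = t := hcf' 1
    have cm' : c' m = s := hcf' 2
    have cl' : c' l = t := hcf' 3
    have h1 := hW j k hjk c hc (by rwa [cj, ck])
    have h2 := hW l m hlm c hc (by rwa [cl, cm])
    have h3 := hW j k hjk c' hc' (by rwa [cj', ck'])
    have h4 := hW l m hlm c' hc' (by rw [cl', cm']; exact hst.symm)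
    rw [h1, ck, cm] at h2
    rw [h3, ck', cm', hneg s t hst] at h4
    have h5 : (x k - x j) * ψ t = 0 := by linear_combination (h2 + h4) / 2
    exact (mul_eq_zero.mp h5).elim (fun h ↦ hjk (sub_eq_zero.mp h).symm)
      (fun h ↦ by simpa [h] using hpow t)
  by_cases hother : ∃ l, l ≠ j ∧ l ≠ k
  · obtain ⟨l, hlj, hlk⟩ := hother
    -- Three distinct weights would give signs `±1` adding up to another `±1`, which is impossible.
    have hcases : x l = x j ∨ x l = x k := by
      by_contra! h
      have h1 := hsq j k hjk
      have h2 := hsq k l h.2.symm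
      have h3 := hsq l j h.1
      have h4 : 2 * ((x k - x j) * (x l - x k)) = -1 := by linear_combination h3 - h1 - h2
      have h5 : (4 : ℂ) = 1 := by
        have : (2 * ((x k - x j) * (x l - x k))) ^ 2 = 4 * ((x k - x j) ^ 2 * (x l - x k) ^ 2) := by
          ring
        rw [h4, h1, h2] at this
        linear_combination -this
      norm_num at h5
    rcases hcases with h | h
    · refine ⟨j, k, (coloringSum_eq_or ψ hC hx hψ hc₀ hsurj hjk).1, fun m hm ↦ ?_⟩
      by_cases hmj : m = j
      · rw [hmj]
      · rw [hdisj m l hmj hm hlj hlk, h]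
    · refine ⟨k, j, (coloringSum_eq_or ψ hC hx hψ hc₀ hsurj hjk.symm).1, fun m hm ↦ ?_⟩
      by_cases hmk : m = k
      · rw [hmk]
      · rw [hdisj m l hm hmk hlj hlk, h]
  · push Not at hother
    refine ⟨j, k, (coloringSum_eq_or ψ hC hx hψ hc₀ hsurj hjk).1, fun m hm ↦ ?_⟩
    by_cases hmj : m = j
    · rw [hmj]
    · exact absurd (hother m hmj) hm

end AddChar

/-! ### Balanced colourings. -/

namespace AddChar

variable {ι : Type*} [Fintype ι] [DecidableEq ι] {p : ℕ}

theorem exists_card_mul_norm_eq_one [hp : Fact p.Prime] (ψ : AddChar (ZMod p) ℂ)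
    (hψ : Function.Injective ψ) {k : ℕ} (hk : p = 2 → 2 ≤ k) (hk0 : 0 < k)
    (hι : Fintype.card ι = p * k) {x : ι → ℂ}
    (hx : ∀ c : ι → ZMod p, (∀ i, (Finset.univ.filter fun j ↦ c j = i).card = k) →
      ∃ u, coloringSum ψ x c = ψ u) (hsum : ∑ j, x j = 0) :
    ∃ j, (Fintype.card ι : ℝ) * ‖x j‖ = 1 := by
  let C : Set (ι → ZMod p) := {c | ∀ i, (Finset.univ.filter fun j ↦ c j = i).card = k}
  have hC : ∀ c ∈ C, ∀ σ : Equiv.Perm ι, c ∘ σ ∈ C := by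
    intro c hc σ i
    rw [← hc i]
    exact Finset.card_equiv σ (by simp)
  have hk' : NeZero k := ⟨hk0.ne'⟩
  have e : ι ≃ ZMod p × Fin k := Fintype.equivOfCardEq (by simp [hι])
  have hc₀ : (fun j ↦ (e j).1) ∈ C := by
    intro i
    have : (Finset.univ.filter fun q : ZMod p × Fin k ↦ q.1 = i) = {i} ×ˢ Finset.univ := by
      ext ⟨q, r⟩; simp [eq_comm]
    rw [Finset.card_equiv (t := Finset.univ.filter fun q : ZMod p × Fin k ↦ q.1 = i) e (by simp),
      this]
    simp
  have hsurj : Function.Surjective fun j ↦ (e j).1 := Prod.fst_surjective.comp e.surjective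
  have hcard : (Fintype.card ι : ℂ) ≠ 0 := by
    rw [hι]
    exact Nat.cast_ne_zero.mpr (mul_ne_zero hp.out.ne_zero hk0.ne')
  obtain ⟨j, k, hjk⟩ : ∃ j k, x j ≠ x k := by
    by_contra! h
    have h0 : ∀ j, x j = 0 := by
      intro j
      rw [Finset.sum_congr rfl fun i _ ↦ h i j, Finset.sum_const, nsmul_eq_mul] at hsum
      exact (mul_eq_zero.mp hsum).resolve_left hcard
    obtain ⟨u, hu⟩ := hx _ hc₀
    have h1 : ‖ψ u‖ = 0 := by rw [← hu]; simp [coloringSum, h0]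
    simp at h1
  obtain ⟨j, k, hnorm, heq⟩ : ∃ j k, ‖x k - x j‖ = 1 ∧ ∀ l ≠ k, x l = x j := by
    have hF : ∀ s : ZMod p, p • s = 0 := fun s ↦ by simp
    by_cases hp2 : p = 2
    · subst hp2
      have h2 := hk rfl
      refine exists_forall_ne_eq_of_two ψ hC hx hψ hc₀ hsurj hF (zero_ne_one (α := ZMod 2))
        -- Two indices of each colour, available since `2 ≤ k`.
        (g := fun i ↦ e.symm (![0, 1, 0, 1] i,
          ![⟨0, by omega⟩, ⟨0, by omega⟩, ⟨1, by omega⟩, ⟨1, by omega⟩] i))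
        (e.symm.injective.comp ?_) (fun i ↦ by simp) hjk
      simp [Function.Injective, Fin.forall_fin_succ]
    · exact exists_forall_ne_eq_of_odd ψ hC hx hψ hc₀ hsurj (hp.out.odd_of_ne_two hp2) hF
        (by rw [ZMod.card]; have := hp.out.two_le; omega) hjk
  refine ⟨j, ?_⟩
  have h1 : ∑ l, (x l - x j) = x k - x j :=
    Fintype.sum_eq_single k fun l hl ↦ sub_eq_zero.mpr (heq l hl)
  rw [Finset.sum_sub_distrib, hsum, Finset.sum_const, nsmul_eq_mul, zero_sub] at h1
  rw [← hnorm, ← h1, norm_neg, norm_mul, Complex.norm_natCast, Finset.card_univ]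

end AddChar

/-! ### Walsh values of generated functions. -/

namespace BentPartition

variable {p : ℕ} {V : Type*} [AddCommGroup V] [Module (ZMod p) V] [Fintype V]

theorem walsh_eq_sum_zmodChar [NeZero p] {ζ : ℂ} (hζ : ζ ^ p = 1)
    (B : LinearMap.BilinForm (ZMod p) V) (f : V → ZMod p) (a : V) :
    walsh ζ B f a = ∑ x, AddChar.zmodChar p hζ (f x) * AddChar.zmodChar p hζ (-B a x) := by
  refine Finset.sum_congr rfl fun x _ ↦ ?_
  rw [← AddChar.map_add_eq_mul, ← sub_eq_add_neg, AddChar.zmodChar_apply]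

theorem sum_addChar_neg_eq_zero [Fact p.Prime] {ψ : AddChar (ZMod p) ℂ}
    (hψ : Function.Injective ψ) {B : LinearMap.BilinForm (ZMod p) V} (hB : B.Nondegenerate)
    {a : V} (ha : a ≠ 0) : ∑ x, ψ (-B a x) = 0 := by
  have hψ' : ψ.compAddMonoidHom (-(B a).toAddMonoidHom) ≠ 1 := by
    intro h
    refine ha (hB.1 a fun x ↦ ?_)
    have hx := DFunLike.congr_fun h x
    rw [AddChar.one_apply, ← AddChar.map_zero_eq_one ψ] at hx
    exact neg_eq_zero.mp (hψ hx)
  exact AddChar.sum_eq_zero_of_ne_one hψ'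

variable [DecidableEq V]

/-- The function on `V` that takes the value `c A` on the block `A`. -/
def ofColoring (Γ : Finpartition (Finset.univ : Finset V)) (c : Γ.parts → ZMod p) (x : V) :
    ZMod p :=
  c ⟨Γ.part x, Γ.part_mem.mpr (Finset.mem_univ x)⟩

omit [AddCommGroup V] [Module (ZMod p) V] in
theorem ofColoring_of_mem {Γ : Finpartition (Finset.univ : Finset V)} (c : Γ.parts → ZMod p)
    (A : Γ.parts) {x : V} (hx : x ∈ A.1) : ofColoring Γ c x = c A :=
  congrArg c (Subtype.ext (Γ.part_eq_of_mem A.2 hx))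

omit [AddCommGroup V] [Module (ZMod p) V] in
theorem generatedBy_ofColoring {Γ : Finpartition (Finset.univ : Finset V)} {c : Γ.parts → ZMod p}
    (hc : ∀ i, (Finset.univ.filter fun A ↦ c A = i).card = depth Γ / p) :
    GeneratedBy Γ (ofColoring Γ c) := by
  intro i
  rw [← hc i]
  symm
  refine Finset.card_bij (fun A _ ↦ A.1) ?_ (fun A _ A' _ h ↦ Subtype.ext h) ?_
  · intro A hA
    simp only [Finset.mem_filter, Finset.mem_univ, true_and] at hA
    exact Finset.mem_filter.mpr ⟨A.2, fun x hx ↦ (ofColoring_of_mem c A hx).trans hA⟩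
  · intro A hA
    obtain ⟨hA, h⟩ := Finset.mem_filter.mp hA
    obtain ⟨x, hx⟩ := Γ.nonempty_of_mem_parts hA
    exact ⟨⟨A, hA⟩, by simpa using (ofColoring_of_mem c ⟨A, hA⟩ hx).symm.trans (h x hx), rfl⟩

omit [AddCommGroup V] in
theorem sum_eq_sum_parts (Γ : Finpartition (Finset.univ : Finset V)) (g : V → ℂ) :
    ∑ x, g x = ∑ A : Γ.parts, ∑ x ∈ A.1, g x := by
  rw [Finset.univ_eq_attach, Finset.sum_attach Γ.parts fun A ↦ ∑ x ∈ A, g x]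
  conv_lhs => rw [← Γ.biUnion_parts]
  exact Finset.sum_biUnion Γ.supIndep.pairwiseDisjoint

theorem walsh_ofColoring [NeZero p] {ζ : ℂ} (hζ : ζ ^ p = 1) (B : LinearMap.BilinForm (ZMod p) V)
    (Γ : Finpartition (Finset.univ : Finset V)) (c : Γ.parts → ZMod p) (a : V) :
    walsh ζ B (ofColoring Γ c) a = AddChar.coloringSum (AddChar.zmodChar p hζ)
      (fun A : Γ.parts ↦ ∑ x ∈ A.1, AddChar.zmodChar p hζ (-B a x)) c := by
  rw [walsh_eq_sum_zmodChar hζ, sum_eq_sum_parts Γ, AddChar.coloringSum]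
  refine Finset.sum_congr rfl fun A _ ↦ ?_
  rw [Finset.mul_sum]
  exact Finset.sum_congr rfl fun x hx ↦ by rw [ofColoring_of_mem c A hx]

theorem zmodChar_injective [NeZero p] {ζ : ℂ} (hζ : IsPrimitiveRoot ζ p) :
    Function.Injective (AddChar.zmodChar p hζ.pow_eq_one) := by
  intro s t h
  rw [AddChar.zmodChar_apply, AddChar.zmodChar_apply] at h
  exact ZMod.val_injective p (hζ.pow_inj s.val_lt t.val_lt h)

theorem depth_eq_pow [hp : Fact p.Prime] {m : ℕ} {ζ : ℂ} (hζ : IsPrimitiveRoot ζ p)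
    {B : LinearMap.BilinForm (ZMod p) V} (hB : B.Nondegenerate)
    {Γ : Finpartition (Finset.univ : Finset V)} (hdvd : p ∣ depth Γ) {a : V} (ha : a ≠ 0) {δ : ℂ}
    (hδ : ‖δ‖ = 1) (hwalsh : ∀ f : V → ZMod p, GeneratedBy Γ f → ∃ u,
      walsh ζ B f a = δ * (p : ℂ) ^ m * AddChar.zmodChar p hζ.pow_eq_one u) :
    ∃ r : ℕ, depth Γ = p ^ r := by
  obtain ⟨k, hk⟩ := hdvd
  have hdepth : 0 < depth Γ := by
    refine Finset.card_pos.mpr ⟨Γ.part a, Γ.part_mem.mpr (Finset.mem_univ a)⟩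
  have hk0 : 0 < k := Nat.pos_of_mul_pos_left (hk ▸ hdepth)
  -- Depth `p` needs no argument; for `p = 2` it also lacks the two blocks of each colour used
  -- below.
  by_cases hk1 : k = 1
  · exact ⟨1, by rw [hk, hk1, mul_one, pow_one]⟩
  set ψ := AddChar.zmodChar p hζ.pow_eq_one with hψdef
  have hψ : Function.Injective ψ := zmodChar_injective hζ
  have hp0 : (p : ℂ) ^ m ≠ 0 := pow_ne_zero _ (Nat.cast_ne_zero.mpr hp.out.ne_zero)
  have hδ0 : δ ≠ 0 := norm_ne_zero_iff.mp (by rw [hδ]; exact one_ne_zero)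
  set χ : Γ.parts → ℂ := fun A ↦ ∑ x ∈ A.1, ψ (-B a x) with hχ
  have hcard : Fintype.card Γ.parts = depth Γ := Fintype.card_coe _
  obtain ⟨A, hA⟩ := AddChar.exists_card_mul_norm_eq_one (ι := Γ.parts) ψ hψ (k := k)
    (fun _ ↦ by omega) hk0 (hcard.trans hk) (x := fun A ↦ (δ * (p : ℂ) ^ m)⁻¹ * χ A)
    (fun c hc ↦ by
      obtain ⟨u, hu⟩ := hwalsh _ (generatedBy_ofColoring (Γ := Γ) (c := c) fun i ↦ by
        rw [hc i, hk, Nat.mul_div_cancel_left _ hp.out.pos])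
      rw [walsh_ofColoring hζ.pow_eq_one] at hu
      refine ⟨u, ?_⟩
      have : AddChar.coloringSum ψ (fun A ↦ (δ * (p : ℂ) ^ m)⁻¹ * χ A) c =
          (δ * (p : ℂ) ^ m)⁻¹ * AddChar.coloringSum ψ χ c := by
        rw [AddChar.coloringSum, AddChar.coloringSum, Finset.mul_sum]
        exact Finset.sum_congr rfl fun A _ ↦ by ring
      rw [this, hu]
      field_simp)
    (by rw [← Finset.mul_sum, ← sum_eq_sum_parts Γ, sum_addChar_neg_eq_zero hψ hB ha, mul_zero])
  refine exists_eq_pow_of_norm_eq_div (z := χ A) (m := m) ?_ hdepth.ne' ?_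
  · refine IsIntegral.sum _ fun x _ ↦ ?_
    rw [hψdef, AddChar.zmodChar_apply]
    exact (hζ.isIntegral hp.out.pos).pow _
  · rw [hcard, norm_mul, norm_inv, norm_mul, hδ, norm_pow, Complex.norm_natCast] at hA
    have : (p : ℝ) ^ m ≠ 0 := pow_ne_zero _ (Nat.cast_ne_zero.mpr hp.out.ne_zero)
    field_simp at hA
    exact hA

omit [Fintype V] [DecidableEq V] in
theorem rpow_finrank_div_two {m : ℕ} (h : Module.finrank (ZMod p) V = m + m) :
    (p : ℝ) ^ ((Module.finrank (ZMod p) V : ℝ) / 2) = (p : ℝ) ^ m := by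
  rw [h, ← Real.rpow_natCast]
  congr 1
  push_cast
  ring

omit [DecidableEq V] in
-- The Walsh value is an integer of absolute value `2 ^ m`, and its sign is itself a value of `ψ`.
-- Bentness alone thus gives `δ = 1`.
theorem IsBent.exists_walsh_eq_of_two [Module (ZMod 2) V] {m : ℕ}
    (h : Module.finrank (ZMod 2) V = m + m) {ζ : ℂ} (hζ : IsPrimitiveRoot ζ 2)
    {B : LinearMap.BilinForm (ZMod 2) V} {f : V → ZMod 2} (hf : IsBent ζ B f) (a : V) :
    ∃ u, walsh ζ B f a = 1 * ((2 : ℕ) : ℂ) ^ m * AddChar.zmodChar 2 hζ.pow_eq_one u := by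
  have hζ' : ζ = -1 := hζ.eq_neg_one_of_two_right
  have hnorm := hf a
  rw [rpow_finrank_div_two h] at hnorm
  have hw : walsh ζ B f a = ((∑ x, (-1) ^ (f x - B a x).val : ℤ) : ℂ) := by
    simp [walsh, hζ']
  rw [hw] at hnorm ⊢
  generalize (∑ x, (-1) ^ (f x - B a x).val : ℤ) = z at hnorm
  rw [Complex.norm_intCast] at hnorm
  have hz : |z| = 2 ^ m := by exact_mod_cast hnorm
  rcases (abs_eq (by positivity)).mp hz with rfl | rfl
  · exact ⟨0, by simp⟩
  · refine ⟨1, ?_⟩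
    rw [AddChar.zmodChar_apply, hζ', ZMod.val_one]
    push_cast
    ring

omit [DecidableEq V] in
theorem HasConstantUnit.exists_walsh_eq [hp : Fact p.Prime] {m : ℕ}
    (h : Module.finrank (ZMod p) V = m + m) {ζ : ℂ} (hζ : IsPrimitiveRoot ζ p)
    {B : LinearMap.BilinForm (ZMod p) V} {f : V → ZMod p} {ε : ℂ} (hf : HasConstantUnit ζ B f ε)
    (a : V) : ∃ u, walsh ζ B f a = ε * (p : ℂ) ^ m * AddChar.zmodChar p hζ.pow_eq_one u := by
  obtain ⟨f', hf'⟩ := hf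
  refine ⟨f' a, ?_⟩
  rw [hf', rpow_finrank_div_two h, AddChar.zmodChar_apply]
  push_cast
  rfl

omit [DecidableEq V] in
-- A `p`-th root of unity in the constant is absorbed by translating the dual function.
theorem HasConstantUnit.mul_zmodChar [hp : Fact p.Prime] {ζ : ℂ} (hζ : IsPrimitiveRoot ζ p)
    {B : LinearMap.BilinForm (ZMod p) V} {f : V → ZMod p} {ε : ℂ} {v : ZMod p}
    (hf : HasConstantUnit ζ B f (ε * AddChar.zmodChar p hζ.pow_eq_one v)) :
    HasConstantUnit ζ B f ε := by
  obtain ⟨f', hf'⟩ := hf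
  refine ⟨fun a ↦ v + f' a, fun a ↦ ?_⟩
  rw [hf', ← AddChar.zmodChar_apply hζ.pow_eq_one (v + f' a), AddChar.map_add_eq_mul,
    AddChar.zmodChar_apply _ (f' a)]
  ring

omit [DecidableEq V] in
theorem IsWeaklyRegular.hasConstantUnit_neg_one [hp : Fact p.Prime] (hp2 : p ≠ 2) {m : ℕ}
    (h : Module.finrank (ZMod p) V = m + m) {ζ : ℂ} (hζ : IsPrimitiveRoot ζ p)
    {B : LinearMap.BilinForm (ZMod p) V} {f : V → ZMod p} (hf : IsWeaklyRegular ζ B f)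
    (hf' : ¬ IsRegular ζ B f) : HasConstantUnit ζ B f (-1) := by
  obtain ⟨hbent, ε, hε⟩ := hf
  set ψ := AddChar.zmodChar p hζ.pow_eq_one with hψ
  obtain ⟨u, hu⟩ := hε.exists_walsh_eq h hζ 0
  have hp0 : (p : ℂ) ^ m ≠ 0 := pow_ne_zero _ (Nat.cast_ne_zero.mpr hp.out.ne_zero)
  have hnorm := hbent 0
  rw [rpow_finrank_div_two h] at hnorm
  obtain ⟨r, hr⟩ := eq_pow_or_eq_neg_pow_of_norm_eq hp2 hζ _ _ hnorm
  change walsh ζ B f 0 = _ ∨ walsh ζ B f 0 = _ at hr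
  rw [hu, ← hψ, ← AddChar.zmodChar_apply' hζ.pow_eq_one r, ← hψ] at hr
  have hinv : ψ u * ψ (-u) = 1 := by
    rw [← AddChar.map_add_eq_mul, add_neg_cancel, AddChar.map_zero_eq_one]
  -- With the plus sign `ε` is a `p`-th root of unity and `f` would be regular; with the minus sign
  -- it is `-1` times one.
  rcases hr with hr | hr
  · refine absurd ⟨hbent, HasConstantUnit.mul_zmodChar hζ (v := r - u) ?_⟩ hf'
    convert! hε using 1
    apply mul_left_cancel₀ hp0
    rw [← hψ, sub_eq_add_neg, AddChar.map_add_eq_mul]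
    linear_combination -ψ (-u) * hr + ε * p ^ m * hinv
  · refine HasConstantUnit.mul_zmodChar hζ (v := r - u) ?_
    convert! hε using 1
    apply mul_left_cancel₀ hp0
    rw [← hψ, sub_eq_add_neg, AddChar.map_add_eq_mul]
    linear_combination -ψ (-u) * hr + ε * p ^ m * hinv

end BentPartition

theorem theorem3 (p : ℕ) [Fact p.Prime] (n : ℕ) (hn_pos : 0 < n) (hn_even : Even n)
    (V : Type*) [AddCommGroup V] [Module (ZMod p) V] [Fintype V] [DecidableEq V]
    (hV : Module.finrank (ZMod p) V = n)
    (ζ : ℂ) (hζ : IsPrimitiveRoot ζ p)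
    (B : LinearMap.BilinForm (ZMod p) V) (hB : B.Nondegenerate)
    (Γ : Finpartition (Finset.univ : Finset V)) :
    (BentPartition.InClassWBP ζ B Γ → ∃ m : ℕ, BentPartition.depth Γ = p ^ m) ∧
      (p = 2 → BentPartition.IsBentPartition ζ B Γ →
        ∃ m : ℕ, BentPartition.depth Γ = 2 ^ m) := by
  obtain ⟨m, rfl⟩ := hn_even
  have : Nontrivial V := Module.nontrivial_of_finrank_pos (R := ZMod p) (hV ▸ hn_pos)
  obtain ⟨a, ha⟩ := exists_ne (0 : V)
  have htwo : p = 2 → BentPartition.IsBentPartition ζ B Γ →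
      ∃ m : ℕ, BentPartition.depth Γ = 2 ^ m := by
    rintro rfl hΓ
    exact BentPartition.depth_eq_pow hζ hB hΓ.1 ha norm_one
      fun f hf ↦ (hΓ.2 f hf).exists_walsh_eq_of_two hV hζ a
  refine ⟨fun hΓ ↦ ?_, htwo⟩
  by_cases hp2 : p = 2
  · subst hp2
    exact htwo rfl hΓ.1
  rcases hΓ.2 with hreg | hweak
  · exact BentPartition.depth_eq_pow hζ hB hΓ.1.1 ha norm_one
      fun f hf ↦ (hreg f hf).2.exists_walsh_eq hV hζ a
  · exact BentPartition.depth_eq_pow hζ hB hΓ.1.1 ha (by rw [norm_neg, norm_one])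
      fun f hf ↦ ((hweak f hf).1.hasConstantUnit_neg_one hp2 hV hζ
        (hweak f hf).2).exists_walsh_eq hV hζ a
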